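/- Let $n\ge 2$, let $\Omega\subset\mathbb{R}^n$ be a bounded strictly convex domain and $\Lambda\subset\mathbb{R}^n$ a (possibly unbounded) convex domain with $C^{1,1}$ boundary, and suppose that $\overline\Omega\cap\overline\Lambda=\emptyset$. Here a convex domain is a nonempty open convex set; it is strictly convex if its boundary contains no nondegenerate line segment; and its boundary is $C^{1,1}$ if near each boundary point, after a rotation, the domain is the region below the graph of a differentiable function of $n-1$ variables with Lipschitz gradient. Let $P_\Lambda(x)$ denote the point of $\overline\Lambda$ nearest to $x$, and let $\partial P_\Lambda(\Omega)$ denote the boundary of $P_\Lambda(\Omega)\cap\partial\Lambda$ in the relative topology of $\partial\Lambda$. Then $\partial P_\Lambda(\Omega)$ is finitely $(n-2)$-rectifiable: there are finitely many bounded sets $A_1,\dots,A_N\subset\mathbb{R}^{n-2}$ and Lipschitz maps $f_i:A_i\to\mathbb{R}^n$ such that $\partial P_\Lambda(\Omega)=\bigcup_{i=1}^N f_i(A_i)$. -/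

import Mathlib

namespace ProjectionShadow

/-- A convex domain: a nonempty open convex set. -/
structure IsConvexDomain {E : Type*} [NormedAddCommGroup E] [NormedSpace ℝ E] (U : Set E) :
    Prop where
  isOpen : IsOpen U
  nonempty : U.Nonempty
  convex : Convex ℝ U

/-- A strictly convex domain: a convex domain whose boundary contains no nondegenerate segment,
that is, the open segment between two distinct points of the closure lies in the interior of the
closure. (Strict convexity of the open set itself would be no more than convexity.) -/
structure IsStrictlyConvexDomain {E : Type*} [NormedAddCommGroup E] [NormedSpace ℝ E]
    (U : Set E) : Prop extends IsConvexDomain U where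
  strictConvex_closure : StrictConvex ℝ (closure U)

/-- `U` has a `C^{1,1}` boundary: near each boundary point `y`, and for a suitable unit vector `v`,
the set `U` is the region below the graph, over the hyperplane orthogonal to `v`, of a function
which is differentiable with Lipschitz derivative near the projection of `y`. -/
def HasC11Boundary {E : Type*} [NormedAddCommGroup E] [InnerProductSpace ℝ E]
    (U : Set E) : Prop :=
  ∀ y ∈ frontier U, ∃ v : E, ‖v‖ = 1 ∧
    ∃ φ : (Submodule.span ℝ {v})ᗮ → ℝ, ∃ r : ℝ, 0 < r ∧
      DifferentiableOn ℝ φ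
        (Metric.ball ((Submodule.span ℝ {v})ᗮ.orthogonalProjectionOnto y) r) ∧
      (∃ K : NNReal, LipschitzOnWith K (fderiv ℝ φ)
        (Metric.ball ((Submodule.span ℝ {v})ᗮ.orthogonalProjectionOnto y) r)) ∧
      ∀ z ∈ Metric.ball y r,
        (z ∈ U ↔ inner ℝ v z < φ ((Submodule.span ℝ {v})ᗮ.orthogonalProjectionOnto z))

/-- `y` is the orthogonal projection of `x` onto (the closure of) `L`: the point of `closure L`
nearest to `x`. For a nonempty convex `L` in a Euclidean space it exists and is unique. -/
def IsProjection {E : Type*} [PseudoMetricSpace E] (L : Set E) (x y : E) : Prop :=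
  y ∈ closure L ∧ ∀ z ∈ closure L, dist x y ≤ dist x z

/-- The image of `W` under the orthogonal projection onto (the closure of) `L`. -/
def projectionImage {E : Type*} [PseudoMetricSpace E] (L W : Set E) : Set E :=
  {y | ∃ x ∈ W, IsProjection L x y}

/-- The boundary of the shadow that `W` casts on the boundary of `L`: the boundary of
(projection of `W`) ∩ (boundary of `L`), taken in the relative topology of the boundary of `L`. -/
def shadowBoundary {E : Type*} [PseudoMetricSpace E] (L W : Set E) : Set E :=
  Subtype.val '' frontier {y : frontier L | (y : E) ∈ projectionImage L W}

/-- `S` is finitely `m`-rectifiable: a finite union of Lipschitz images of bounded subsets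
of `ℝ^m`. -/
def IsFinitelyRectifiable {E : Type*} [PseudoMetricSpace E] (m : ℕ) (S : Set E) : Prop :=
  ∃ (N : ℕ) (A : Fin N → Set (EuclideanSpace ℝ (Fin m)))
    (f : Fin N → EuclideanSpace ℝ (Fin m) → E),
    (∀ i, Bornology.IsBounded (A i) ∧ ∃ K : NNReal, LipschitzOnWith K (f i) (A i)) ∧
    S = ⋃ i, f i '' A i

end ProjectionShadow

/-!
Let `y` be a point of the shadow boundary and `ν` the outer unit normal of `Λ` at `y`. The shadow is
relatively open because `ν` is continuous on a `C^{1,1}` boundary (`isOpen_shadow`), so the normal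
ray from `y` touches `closure Ω` at a point `y + t • ν` but misses `Ω`. The whole line through `y`
misses `Ω` too: a point of `Ω` behind `y` and the touching point would span a segment inside `Ω`
that contains `y`. By Hahn-Banach there is a unit vector `m` orthogonal to `ν` such that `closure Ω`
lies on the positive side of the hyperplane through `y` with normal `m`
(`exists_normals_of_mem_shadowBoundary`).

Compare two points `y`, `y'` of the shadow boundary, with data `ν, m, t` and `ν', m', t'`, and put
`a = y' - y`, `b = ν' - ν`. Since both touching points lie in `closure Ω`, `⟪m, a + t' • b⟫ ≥ 0`
and `⟪m', a + t • b⟫ ≤ 0`, using `⟪m, ν⟫ = 0` and `⟪m', ν'⟫ = 0`. By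
convexity of `Λ` the normal is monotone, `⟪a, b⟫ ≥ 0`, and by `C^{1,1}` regularity `‖b‖ ≤ K * ‖a‖`
locally. If `m` and `m'` are both close to a unit vector `m₀`, and `a` is close to a positive
multiple of `m₀`, then `⟪m₀, b⟫` is almost nonnegative by monotonicity, so `⟪m', a + t • b⟫` is
positive, a contradiction; similarly for negative multiples. As `a` is moreover almost orthogonal to
`ν`, it has a definite component orthogonal to `ν₀` and `m₀` (`norm_le_of_increment`). So where
`(ν, m)` varies little, the orthogonal projection to the complement of `ν₀, m₀`, a space of dimension
`n - 2`, is bi-Lipschitz (`isFinitelyRectifiable_of_normals`). As the values of `(ν, m)` and the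
shadow boundary itself are bounded, finitely many such pieces suffice. No continuity of `m` is
needed, nor any smoothness of the boundary of `Ω`.
-/

namespace ProjectionShadow

open Filter Topology RealInnerProductSpace

/-! ### Unit normals of convex sets and of `C^{1,1}` boundaries -/

section Normals

variable {E : Type*} [NormedAddCommGroup E] [InnerProductSpace ℝ E]

/-- `ν` is an outer unit normal to (the closure of) `L` at `y`, in the sense of convex geometry:
`closure L` lies in the half-space through `y` with outer unit normal `ν`. -/
structure IsUnitNormal (L : Set E) (y ν : E) : Prop where
  norm_eq : ‖ν‖ = 1
  inner_le : ∀ w ∈ closure L, ⟪ν, w - y⟫ ≤ 0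

theorem IsUnitNormal.isProjection {L : Set E} {y ν : E} (h : IsUnitNormal L y ν)
    (hy : y ∈ closure L) {t : ℝ} (ht : 0 ≤ t) : IsProjection L (y + t • ν) y := by
  refine ⟨hy, fun z hz => ?_⟩
  have h1 := h.inner_le z hz
  rw [dist_eq_norm, dist_eq_norm]
  have e : y + t • ν - y = t • ν := by abel
  rw [e, norm_smul, h.norm_eq, mul_one, Real.norm_of_nonneg ht]
  have h2 : ⟪ν, y + t • ν - z⟫ = t - ⟪ν, z - y⟫ := by
    simp only [inner_sub_right, inner_add_right, inner_smul_right, real_inner_self_eq_norm_sq,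
      h.norm_eq]
    ring
  have h3 := real_inner_le_norm ν (y + t • ν - z)
  rw [h.norm_eq, one_mul] at h3
  linarith

theorem IsProjection.exists_isUnitNormal {L : Set E} {x y : E} (hL : Convex ℝ L)
    (h : IsProjection L x y) (hxy : x ≠ y) :
    ∃ ν, IsUnitNormal L y ν ∧ x = y + dist x y • ν := by
  have h0 : 0 < ‖x - y‖ := norm_pos_iff.2 (sub_ne_zero.2 hxy)
  have hinf : ‖x - y‖ = ⨅ w : closure L, ‖x - w‖ := by
    have : Nonempty (closure L) := ⟨⟨y, h.1⟩⟩
    refine le_antisymm (le_ciInf fun w => ?_) ?_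
    · simpa only [dist_eq_norm] using h.2 w w.2
    · exact ciInf_le (f := fun w : closure L => ‖x - w‖)
        ⟨0, by rintro _ ⟨w, rfl⟩; exact norm_nonneg _⟩ ⟨y, h.1⟩
  have hin := (norm_eq_iInf_iff_real_inner_le_zero hL.closure h.1).1 hinf
  refine ⟨‖x - y‖⁻¹ • (x - y), ⟨?_, fun w hw => ?_⟩, ?_⟩
  · rw [norm_smul, norm_inv, norm_norm, inv_mul_cancel₀ h0.ne']
  · rw [real_inner_smul_left]
    exact mul_nonpos_of_nonneg_of_nonpos (by positivity) (hin w hw)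
  · rw [dist_eq_norm, smul_smul, mul_inv_cancel₀ h0.ne', one_smul]
    abel

/-- The supporting hyperplane theorem. -/
theorem IsConvexDomain.exists_isUnitNormal [CompleteSpace E] {L : Set E} (hL : IsConvexDomain L)
    {y : E} (hy : y ∈ frontier L) : ∃ ν, IsUnitNormal L y ν := by
  rw [hL.isOpen.frontier_eq] at hy
  obtain ⟨f, hf⟩ := geometric_hahn_banach_open_point hL.convex hL.isOpen hy.2
  set g := (InnerProductSpace.toDual ℝ E).symm f with hg
  have hgf : ∀ z, ⟪g, z⟫ = f z := fun z => InnerProductSpace.toDual_symm_apply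
  have hg0 : 0 < ‖g‖ := by
    rw [norm_pos_iff]
    intro h0
    obtain ⟨p, hp⟩ := hL.nonempty
    have := hf p hp
    simp [← hgf, h0] at this
  refine ⟨‖g‖⁻¹ • g, ⟨?_, fun w hw => ?_⟩⟩
  · rw [norm_smul, norm_inv, norm_norm, inv_mul_cancel₀ hg0.ne']
  · rw [real_inner_smul_left, hgf, map_sub]
    refine mul_nonpos_of_nonneg_of_nonpos (by positivity) (sub_nonpos.2 ?_)
    exact closure_minimal (fun z hz => (hf z hz).le)
      (isClosed_le f.continuous continuous_const) hw

/-- A unit vector whose inner products with the points of the open half-space `⟪N, ·⟫ < 0` are all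
nonpositive is the outer unit normal of that half-space. -/
theorem eq_inv_norm_smul_of_inner_le {N ν : E} (hN : N ≠ 0) (hν : ‖ν‖ = 1)
    (h : ∀ z, ⟪N, z⟫ < 0 → ⟪ν, z⟫ ≤ 0) : ν = ‖N‖⁻¹ • N := by
  have hN0 : 0 < ‖N‖ := norm_pos_iff.2 hN
  set u := ‖N‖⁻¹ • N with hu
  have hu1 : ‖u‖ = 1 := by rw [hu, norm_smul, norm_inv, norm_norm, inv_mul_cancel₀ hN0.ne']
  have hNu : N = ‖N‖ • u := by rw [hu, smul_smul, mul_inv_cancel₀ hN0.ne', one_smul]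
  have h' : ∀ z, ⟪u, z⟫ < 0 → ⟪ν, z⟫ ≤ 0 := fun z hz => h z (by
    rw [hNu, real_inner_smul_left]; exact mul_neg_of_pos_of_neg hN0 hz)
  have huu : ⟪u, u⟫ = 1 := by rw [real_inner_self_eq_norm_sq, hu1]; norm_num
  have hνν : ⟪ν, ν⟫ = 1 := by rw [real_inner_self_eq_norm_sq, hν]; norm_num
  have h1 : 0 ≤ ⟪ν, u⟫ := by
    have := h' (-u) (by rw [inner_neg_right, huu]; norm_num)
    rw [inner_neg_right] at this
    linarith
  have h2 : 1 ≤ ⟪ν, u⟫ := by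
    by_contra! hlt
    -- `ν` minus slightly more than its component along `u` lies in the half-space
    set c := ⟪ν, u⟫ with hc
    have := h' (ν - ((c + 1) / 2) • u) (by
      rw [inner_sub_right, inner_smul_right, huu, real_inner_comm, ← hc]; linarith)
    rw [inner_sub_right, inner_smul_right, hνν, ← hc] at this
    nlinarith
  exact (inner_eq_one_iff_of_norm_eq_one hν hu1).1 (le_antisymm
    (by simpa [hν, hu1] using real_inner_le_norm ν u) h2)

theorem norm_inv_norm_smul_sub_le {N N' : E} (hN : 1 ≤ ‖N‖) (hN' : N' ≠ 0) :
    ‖‖N‖⁻¹ • N - ‖N'‖⁻¹ • N'‖ ≤ 2 * ‖N - N'‖ := by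
  have h0 : 0 < ‖N‖ := by linarith
  have h0' : 0 < ‖N'‖ := norm_pos_iff.2 hN'
  have e : ‖N‖⁻¹ • N - ‖N'‖⁻¹ • N' = ‖N‖⁻¹ • ((N - N') + ((‖N'‖ - ‖N‖) * ‖N'‖⁻¹) • N') := by
    have : ‖N'‖⁻¹ = ‖N‖⁻¹ * (1 - (‖N'‖ - ‖N‖) * ‖N'‖⁻¹) := by field_simp; ring
    rw [this, smul_add, smul_sub, smul_smul, ← this]
    nth_rewrite 1 [this]
    module
  rw [e, norm_smul, norm_inv, norm_norm]
  have h1 : ‖((‖N'‖ - ‖N‖) * ‖N'‖⁻¹) • N'‖ ≤ ‖N - N'‖ := by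
    rw [norm_smul, norm_mul, norm_inv, norm_norm, inv_mul_cancel_right₀ h0'.ne', Real.norm_eq_abs,
      norm_sub_rev]
    exact abs_norm_sub_norm_le N' N
  have h2 := norm_add_le (N - N') (((‖N'‖ - ‖N‖) * ‖N'‖⁻¹) • N')
  calc _ ≤ 1 * (2 * ‖N - N'‖) := by
        gcongr
        · exact inv_le_one_of_one_le₀ hN
        · linarith
    _ = _ := one_mul _

/-- On a `C^{1,1}` boundary the outer unit normal is locally a Lipschitz function: below the graph
of `φ` it is the normalization of `v - ∇φ`. -/
theorem HasC11Boundary.exists_lipschitz_normal [CompleteSpace E] {L : Set E}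
    (hL : HasC11Boundary L) {y₀ : E} (hy₀ : y₀ ∈ frontier L) :
    ∃ r > 0, ∃ K : ℝ, 0 ≤ K ∧ ∀ y ∈ frontier L, ∀ y' ∈ frontier L, y ∈ Metric.ball y₀ r →
      y' ∈ Metric.ball y₀ r → ∀ ν ν', IsUnitNormal L y ν → IsUnitNormal L y' ν' →
      ‖ν - ν'‖ ≤ K * ‖y - y'‖ := by
  obtain ⟨v, hv, φ, r, hr, hd, ⟨K, hK⟩, hU⟩ := hL y₀ hy₀
  set π := (Submodule.span ℝ {v})ᗮ.orthogonalProjectionOnto with hπ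
  have hπ1 : ∀ z, ‖π z‖ ≤ ‖z‖ := fun z =>
    (Submodule.span ℝ {v})ᗮ.norm_orthogonalProjectionOnto_apply_le z
  have hπb : ∀ z ∈ Metric.ball y₀ r, π z ∈ Metric.ball (π y₀) r := fun z hz => by
    rw [mem_ball_iff_norm] at hz ⊢
    rw [← map_sub]
    exact (hπ1 _).trans_lt hz
  have hπv : π v = 0 := by
    rw [hπ, Submodule.orthogonalProjectionOnto_eq_zero_iff, Submodule.orthogonal_orthogonal]
    exact Submodule.mem_span_singleton_self v
  let G : E → StrongDual ℝ E := fun y => innerSL ℝ v - (fderiv ℝ φ (π y)).comp π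
  let N : E → E := fun y => (InnerProductSpace.toDual ℝ E).symm (G y)
  have hNi : ∀ y z, ⟪N y, z⟫ = ⟪v, z⟫ - fderiv ℝ φ (π y) (π z) := fun y z => by
    rw [InnerProductSpace.toDual_symm_apply]
    simp [G]
  have hN1 : ∀ y, 1 ≤ ‖N y‖ := fun y => by
    have h1 := real_inner_le_norm (N y) v
    rw [hNi, hπv, map_zero, real_inner_self_eq_norm_sq, hv] at h1
    linarith
  have hN0 : ∀ y, N y ≠ 0 := fun y => norm_pos_iff.1 (by linarith [hN1 y])
  have hNL : ∀ y ∈ Metric.ball y₀ r, ∀ y' ∈ Metric.ball y₀ r,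
      ‖N y - N y'‖ ≤ K * ‖y - y'‖ := fun y hy y' hy' => by
    have e : G y - G y' = -((fderiv ℝ φ (π y) - fderiv ℝ φ (π y')).comp π) := by
      ext z; simp [G]
    have h1 : ‖fderiv ℝ φ (π y) - fderiv ℝ φ (π y')‖ ≤ K * ‖y - y'‖ := by
      have := hK.dist_le_mul _ (hπb y hy) _ (hπb y' hy')
      rw [dist_eq_norm, dist_eq_norm, ← map_sub] at this
      exact this.trans (by gcongr; exact hπ1 _)
    have h2 : ‖π‖ ≤ 1 := (Submodule.span ℝ {v})ᗮ.orthogonalProjectionOnto_norm_le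
    rw [← map_sub, LinearIsometryEquiv.norm_map, e, norm_neg]
    calc _ ≤ _ := ContinuousLinearMap.opNorm_comp_le _ _
      _ ≤ (K * ‖y - y'‖) * 1 := by gcongr
      _ = _ := mul_one _
  have key : ∀ y ∈ frontier L, y ∈ Metric.ball y₀ r → ∀ ν, IsUnitNormal L y ν →
      ν = ‖N y‖⁻¹ • N y := by
    intro y hyL hy ν hν
    have hball : ∀ᶠ z in 𝓝 y, z ∈ Metric.ball y₀ r := Metric.isOpen_ball.mem_nhds hy
    have hdφ : HasFDerivAt φ (fderiv ℝ φ (π y)) (π y) :=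
      (hd.differentiableAt (Metric.isOpen_ball.mem_nhds (hπb y hy))).hasFDerivAt
    have hle : ⟪v, y⟫ ≤ φ (π y) := by
      by_contra! hlt
      have hc1 : ContinuousAt (fun z => φ (π z)) y :=
        ContinuousAt.comp (f := π) hdφ.continuousAt π.continuous.continuousAt
      have hc2 : ContinuousAt (fun z => ⟪v, z⟫) y := by fun_prop
      have hev : ∀ᶠ z in 𝓝 y, z ∉ L := by
        filter_upwards [hc1.eventually_lt hc2 hlt, hball] with z hz1 hz2 hz3
        exact lt_asymm hz1 ((hU z hz2).1 hz3)
      exact (mem_closure_iff_frequently.1 (frontier_subset_closure hyL)) hev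
    refine eq_inv_norm_smul_of_inner_le (hN0 y) hν.norm_eq fun h hh => ?_
    rw [hNi] at hh
    -- moving from `y` in the direction `h` one enters `L`
    have hline : HasDerivAt (fun s : ℝ => y + s • h) h 0 := by
      simpa using ((hasDerivAt_id (0 : ℝ)).smul_const h).const_add y
    have hπline : HasDerivAt (fun s : ℝ => π (y + s • h)) (π h) 0 :=
      π.hasFDerivAt.comp_hasDerivAt 0 hline
    have hder : HasDerivAt (fun s : ℝ => φ (π (y + s • h)) - ⟪v, y + s • h⟫)
        (fderiv ℝ φ (π y) (π h) - ⟪v, h⟫) 0 := by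
      refine HasDerivAt.sub ?_ ?_
      · refine HasFDerivAt.comp_hasDerivAt (f := fun s : ℝ => π (y + s • h)) 0 ?_ hπline
        simpa using hdφ
      · exact (innerSL ℝ v).hasFDerivAt.comp_hasDerivAt 0 hline
    have hslope := hder.tendsto_slope_zero_right.eventually_const_lt
      (show (0 : ℝ) < _ by linarith)
    have hball' : ∀ᶠ s in 𝓝[>] (0 : ℝ), y + s • h ∈ Metric.ball y₀ r :=
      Filter.Tendsto.eventually (by
        have : Tendsto (fun s : ℝ => y + s • h) (𝓝 0) (𝓝 (y + (0 : ℝ) • h)) :=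
          hline.continuousAt.tendsto
        rw [zero_smul, add_zero] at this
        exact this.mono_left nhdsWithin_le_nhds) hball
    obtain ⟨s, hs1, hs2, hs3⟩ := (hslope.and (hball'.and self_mem_nhdsWithin)).exists
    have hs3 : 0 < s := hs3
    have hpos := (mul_pos hs3 hs1)
    simp only [zero_add, zero_smul, add_zero, smul_eq_mul, mul_inv_cancel_left₀ hs3.ne'] at hpos
    have hmem : y + s • h ∈ L := (hU _ hs2).2 (by linarith)
    have := hν.inner_le _ (subset_closure hmem)
    rw [add_sub_cancel_left, inner_smul_right] at this
    exact nonpos_of_mul_nonpos_right this hs3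
  refine ⟨r, hr, 2 * K, by positivity, fun y hyL y' hyL' hy hy' ν ν' hν hν' => ?_⟩
  rw [key y hyL hy ν hν, key y' hyL' hy' ν' hν']
  have h1 := norm_inv_norm_smul_sub_le (hN1 y) (hN0 y')
  have h2 := hNL y hy y' hy'
  linarith

end Normals

/-! ### Finitely rectifiable sets -/

section Rectifiable

theorem IsFinitelyRectifiable.of_finite {E ι : Type*} [PseudoMetricSpace E] [Finite ι] {m : ℕ}
    (A : ι → Set (EuclideanSpace ℝ (Fin m))) (f : ι → EuclideanSpace ℝ (Fin m) → E)
    (h : ∀ i, Bornology.IsBounded (A i) ∧ ∃ K : NNReal, LipschitzOnWith K (f i) (A i)) :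
    IsFinitelyRectifiable m (⋃ i, f i '' A i) := by
  obtain ⟨N, ⟨e⟩⟩ := Finite.exists_equiv_fin ι
  refine ⟨N, A ∘ e.symm, f ∘ e.symm, fun i => h (e.symm i), ?_⟩
  exact (e.symm.surjective.iUnion_comp fun i => f i '' A i).symm

theorem IsFinitelyRectifiable.iUnion {E ι : Type*} [PseudoMetricSpace E] [Finite ι] {m : ℕ}
    {S : ι → Set E} (h : ∀ i, IsFinitelyRectifiable m (S i)) :
    IsFinitelyRectifiable m (⋃ i, S i) := by
  choose N A f hA hS using h
  have := IsFinitelyRectifiable.of_finite (ι := Σ i, Fin (N i)) (fun p => A p.1 p.2)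
    (fun p => f p.1 p.2) (fun p => hA p.1 p.2)
  rwa [Set.iUnion_sigma, ← Set.iUnion_congr hS] at this

theorem IsFinitelyRectifiable.empty {E : Type*} [PseudoMetricSpace E] {m : ℕ} :
    IsFinitelyRectifiable m (∅ : Set E) :=
  ⟨0, Fin.elim0, Fin.elim0, fun i => i.elim0, by simp⟩

/-- A bounded set on which some linear map to `ℝ^m` is bounded below is a single Lipschitz image,
under the inverse of that map. -/
theorem IsFinitelyRectifiable.of_antilipschitz {E : Type*} [NormedAddCommGroup E]
    [NormedSpace ℝ E] {m : ℕ} {T : Set E} (hT : Bornology.IsBounded T)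
    (π : E →L[ℝ] EuclideanSpace ℝ (Fin m)) {C : ℝ} (hC : 0 ≤ C)
    (h : ∀ y ∈ T, ∀ y' ∈ T, ‖y - y'‖ ≤ C * ‖π (y - y')‖) : IsFinitelyRectifiable m T := by
  have hinj : Set.InjOn π T := fun y hy y' hy' he => by
    have := h y hy y' hy'
    rw [map_sub, he, sub_self, norm_zero, mul_zero] at this
    exact sub_eq_zero.1 (norm_le_zero_iff.1 this)
  have hinv : ∀ y ∈ T, Function.invFunOn π T (π y) = y := hinj.leftInvOn_invFunOn
  have := IsFinitelyRectifiable.of_finite (ι := Unit) (fun _ => π '' T)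
    (fun _ => Function.invFunOn π T) (fun _ => ⟨π.lipschitz.isBounded_image hT, C.toNNReal, by
      refine LipschitzOnWith.of_dist_le_mul ?_
      rintro _ ⟨y, hy, rfl⟩ _ ⟨y', hy', rfl⟩
      rw [hinv y hy, hinv y' hy', Real.coe_toNNReal _ hC, dist_eq_norm, dist_eq_norm, ← map_sub]
      exact h y hy y' hy'⟩)
  rw [Set.iUnion_const, hinj.leftInvOn_invFunOn.image_image] at this
  exact this

/-- Coordinates on the orthogonal complement of an orthonormal pair, in which the norm is given by
Pythagoras' theorem. -/
theorem exists_projection_orthonormal_pair {n : ℕ} {ν m : EuclideanSpace ℝ (Fin n)}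
    (hν : ‖ν‖ = 1) (hm : ‖m‖ = 1) (hνm : ⟪ν, m⟫ = 0) :
    ∃ π : EuclideanSpace ℝ (Fin n) →L[ℝ] EuclideanSpace ℝ (Fin (n - 2)),
      ∀ a, ‖π a‖ = ‖a - ⟪ν, a⟫ • ν - ⟪m, a⟫ • m‖ := by
  have horth : Orthonormal ℝ ![ν, m] := by
    refine ⟨fun i => by fin_cases i <;> simp [hν, hm], fun i j hij => ?_⟩
    fin_cases i <;> fin_cases j <;> simp_all [real_inner_comm]
  set V := Submodule.span ℝ (Set.range ![ν, m]) with hV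
  have hdim : Module.finrank ℝ V = 2 := by
    simpa using finrank_span_eq_card horth.linearIndependent
  have hdim' : Module.finrank ℝ Vᗮ = n - 2 := by
    have := V.finrank_add_finrank_orthogonal
    rw [hdim, finrank_euclideanSpace_fin] at this
    omega
  let e : Vᗮ ≃ₗᵢ[ℝ] EuclideanSpace ℝ (Fin (n - 2)) :=
    ((stdOrthonormalBasis ℝ Vᗮ).reindex (finCongr hdim')).repr
  refine ⟨e.toContinuousLinearEquiv.toContinuousLinearMap.comp Vᗮ.orthogonalProjectionOnto,
    fun a => ?_⟩
  have h1 : ((Vᗮ.orthogonalProjectionOnto a : Vᗮ) : EuclideanSpace ℝ (Fin n)) =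
      a - ⟪ν, a⟫ • ν - ⟪m, a⟫ • m := by
    have hV' : V = Submodule.span ℝ {ν, m} := by
      rw [hV, Matrix.range_cons, Matrix.range_cons, Matrix.range_empty, Set.union_empty]; rfl
    refine Submodule.eq_starProjection_of_mem_orthogonal' (z := ⟪ν, a⟫ • ν + ⟪m, a⟫ • m)
      ?_ ?_ (by abel)
    · rw [hV', Submodule.mem_orthogonal]
      intro w hw
      obtain ⟨s, t, rfl⟩ := Submodule.mem_span_pair.1 hw
      have h3 : ⟪m, ν⟫ = 0 := by rw [real_inner_comm, hνm]
      simp only [inner_add_left, inner_sub_right, real_inner_smul_left, inner_smul_right, h3, hνm,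
        real_inner_self_eq_norm_sq, hν, hm]
      ring
    · rw [Submodule.orthogonal_orthogonal, hV']
      exact Submodule.mem_span_pair.2 ⟨_, _, rfl⟩
  change ‖e (Vᗮ.orthogonalProjectionOnto a)‖ = _
  rw [LinearIsometryEquiv.norm_map, ← h1, Submodule.coe_norm]

end Rectifiable

/-! ### The cone estimate -/

section Cone

variable {E : Type*} [NormedAddCommGroup E] [InnerProductSpace ℝ E]

/-- The one-sided form of the cone estimate: the increment `a` of a point and the increment `b` of
its normal satisfy `0 ≤ ⟪a, b⟫`, whereas `a + t • b` hardly points to the side of `m` (`hβa`). Hence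
`a` cannot be close to `m`: it has a definite component orthogonal to `ν` and `m`. -/
theorem norm_le_of_increment {ν m a b c : E} {α β t ε K R : ℝ}
    (hν : ‖ν‖ = 1) (hm : ‖m‖ = 1) (hνm : ⟪ν, m⟫ = 0) (hα : α = ⟪ν, a⟫) (hβ : β = ⟪m, a⟫)
    (hc : c = a - α • ν - β • m) (hK : 0 ≤ K) (ht : 0 ≤ t) (htR : t ≤ R)
    (hε : 0 ≤ ε) (hε' : 4 * ε * (1 + R * K) ≤ 1) (hb : ‖b‖ ≤ K * ‖a‖) (hab : 0 ≤ ⟪a, b⟫)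
    (hαa : |α| ≤ ε * ‖a‖) (hβ0 : 0 ≤ β) (hβa : β + t * ⟪m, b⟫ ≤ ε * (1 + R * K) * ‖a‖) :
    ‖a‖ ≤ 3 * (1 + R * K) * ‖c‖ := by
  have hR : 0 ≤ R := ht.trans htR
  have hRK : 0 ≤ R * K := mul_nonneg hR hK
  have haeq : a = α • ν + β • m + c := by rw [hc]; abel
  have hβle : β ≤ ‖a‖ := by
    rw [hβ]; simpa [hm] using real_inner_le_norm m a
  have hpyth : ‖a‖ ^ 2 = α ^ 2 + β ^ 2 + ‖c‖ ^ 2 := by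
    have e : ‖c‖ ^ 2 = ‖a‖ ^ 2 - α ^ 2 - β ^ 2 := by
      rw [← real_inner_self_eq_norm_sq, ← real_inner_self_eq_norm_sq, hc]
      have h1 : ⟪ν, ν⟫ = 1 := by rw [real_inner_self_eq_norm_sq, hν]; norm_num
      have h2 : ⟪m, m⟫ = 1 := by rw [real_inner_self_eq_norm_sq, hm]; norm_num
      have h3 : ⟪m, ν⟫ = 0 := by rw [real_inner_comm, hνm]
      have h4 : ⟪a, ν⟫ = α := by rw [real_inner_comm, hα]
      have h5 : ⟪a, m⟫ = β := by rw [real_inner_comm, hβ]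
      simp only [inner_sub_left, inner_sub_right, real_inner_smul_left, inner_smul_right, h1, h2,
        h3, h4, h5, hνm, ← hα, ← hβ]
      ring
    linarith
  have hca : ‖c‖ ≤ ‖a‖ := by
    refine le_of_sq_le_sq ?_ (norm_nonneg a)
    nlinarith [sq_nonneg α, sq_nonneg β]
  have hab' : 0 ≤ α * ⟪ν, b⟫ + β * ⟪m, b⟫ + ⟪c, b⟫ := by
    have : ⟪a, b⟫ = α * ⟪ν, b⟫ + β * ⟪m, b⟫ + ⟪c, b⟫ := by
      nth_rewrite 1 [haeq]
      simp only [inner_add_left, real_inner_smul_left]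
    linarith
  have hνb : α * ⟪ν, b⟫ ≤ ε * ‖a‖ * (K * ‖a‖) := by
    have h1 : |⟪ν, b⟫| ≤ K * ‖a‖ := (abs_real_inner_le_norm ν b).trans (by rwa [hν, one_mul])
    calc α * ⟪ν, b⟫ ≤ |α * ⟪ν, b⟫| := le_abs_self _
      _ = |α| * |⟪ν, b⟫| := abs_mul _ _
      _ ≤ _ := by gcongr
  have hcb : ⟪c, b⟫ ≤ ‖c‖ * (K * ‖a‖) := (real_inner_le_norm c b).trans (by gcongr)
  have hA := norm_nonneg a
  have hC := norm_nonneg c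
  set q := ε * (1 + R * K) with hq
  have hq0 : 0 ≤ q := by positivity
  -- multiplied by `β`, the bound `hβa` can be combined with the lower bound that `hab'` gives for
  -- `β * ⟪m, b⟫`; a bound for `⟪m, b⟫` itself would involve a division by `β`
  have hβ2 : β ^ 2 ≤ q * ‖a‖ ^ 2 + R * (ε * ‖a‖ * (K * ‖a‖) + ‖c‖ * (K * ‖a‖)) := by
    have h1 : β * β + t * (β * ⟪m, b⟫) ≤ q * ‖a‖ * ‖a‖ := by
      calc _ = β * (β + t * ⟪m, b⟫) := by ring
        _ ≤ β * (q * ‖a‖) := by gcongr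
        _ ≤ ‖a‖ * (q * ‖a‖) := by gcongr
        _ = _ := by ring
    have h2 : -(t * (β * ⟪m, b⟫)) ≤ R * (ε * ‖a‖ * (K * ‖a‖) + ‖c‖ * (K * ‖a‖)) := by
      calc _ = t * -(β * ⟪m, b⟫) := by ring
        _ ≤ t * (ε * ‖a‖ * (K * ‖a‖) + ‖c‖ * (K * ‖a‖)) := by gcongr; linarith
        _ ≤ _ := by gcongr
    nlinarith
  have hα2 : α ^ 2 ≤ ε ^ 2 * ‖a‖ ^ 2 := by
    rw [← sq_abs, ← mul_pow]; gcongr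
  have hε4 : ε ≤ 1 / 4 := by nlinarith
  have hε2 : ε ^ 2 ≤ 1 / 16 := by nlinarith
  have hεq : ε * (R * K) ≤ q := by rw [hq]; nlinarith
  rcases hA.eq_or_lt with h0 | h0
  · rw [← h0]; positivity
  · refine le_of_mul_le_mul_left ?_ h0
    have h1 : ‖c‖ ^ 2 ≤ ‖a‖ * ‖c‖ := by rw [sq]; gcongr
    have h2 : ε ^ 2 * ‖a‖ ^ 2 ≤ 1 / 16 * ‖a‖ ^ 2 := by gcongr
    have h3 : q * ‖a‖ ^ 2 ≤ 1 / 4 * ‖a‖ ^ 2 := by gcongr; linarith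
    have h4 : ε * (R * K) * ‖a‖ ^ 2 ≤ 1 / 4 * ‖a‖ ^ 2 := by gcongr; linarith
    have h5 : 0 ≤ ‖a‖ * ‖c‖ := by positivity
    have h6 : 0 ≤ R * K * (‖a‖ * ‖c‖) := by positivity
    have h7 : ‖a‖ * ‖a‖ = ‖a‖ ^ 2 := (sq _).symm
    have h8 : R * (ε * ‖a‖ * (K * ‖a‖) + ‖c‖ * (K * ‖a‖)) =
        ε * (R * K) * ‖a‖ ^ 2 + R * K * (‖a‖ * ‖c‖) := by ring
    have h9 : ‖a‖ * (3 * (1 + R * K) * ‖c‖) = 3 * (‖a‖ * ‖c‖) + 3 * (R * K * (‖a‖ * ‖c‖)) := by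
      ring
    rw [h7, h9]
    linarith

end Cone

/-! ### Rectifiability from a field of normals -/

section Pieces

/-- A bounded set is finitely `(n - 2)`-rectifiable if its points `y` carry orthonormal pairs
`ν y`, `m y` such that `ν` is Lipschitz, the set lies behind each of the hyperplanes through `y`
with normal `ν y`, and the points `y' + t y' • ν y'`, at bounded distance along the normals, lie on
the positive side of each of the hyperplanes through `y` with normal `m y`. -/
theorem isFinitelyRectifiable_of_normals {n : ℕ} {T : Set (EuclideanSpace ℝ (Fin n))}
    (hT : Bornology.IsBounded T) (ν m : EuclideanSpace ℝ (Fin n) → EuclideanSpace ℝ (Fin n))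
    (t : EuclideanSpace ℝ (Fin n) → ℝ) {R K : ℝ} (hR : 0 ≤ R) (hK : 0 ≤ K)
    (hν : ∀ y ∈ T, ‖ν y‖ = 1) (hm : ∀ y ∈ T, ‖m y‖ = 1) (hνm : ∀ y ∈ T, ⟪ν y, m y⟫ = 0)
    (ht : ∀ y ∈ T, 0 ≤ t y) (htR : ∀ y ∈ T, t y ≤ R)
    (hnormal : ∀ y ∈ T, ∀ y' ∈ T, ⟪ν y, y' - y⟫ ≤ 0)
    (hsupp : ∀ y ∈ T, ∀ y' ∈ T, 0 ≤ ⟪m y, y' + t y' • ν y' - y⟫)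
    (hLip : ∀ y ∈ T, ∀ y' ∈ T, ‖ν y - ν y'‖ ≤ K * ‖y - y'‖) :
    IsFinitelyRectifiable (n - 2) T := by
  have hRK : 0 ≤ R * K := mul_nonneg hR hK
  obtain ⟨ε, hε, hε'⟩ : ∃ ε : ℝ, 0 < ε ∧ 4 * ε * (1 + R * K) ≤ 1 :=
    ⟨1 / (4 * (1 + R * K)), by positivity, by field_simp; rfl⟩
  -- the sets of points where the pair `(ν, m)` varies by at most `ε`
  obtain ⟨F, hF, hcover⟩ := Metric.totallyBounded_iff.1
    (isCompact_closedBall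
      (0 : EuclideanSpace ℝ (Fin n) × EuclideanSpace ℝ (Fin n)) 1).totallyBounded
    (ε / 2) (half_pos hε)
  have hTF : T = ⋃ p : F, {y ∈ T | (ν y, m y) ∈ Metric.ball p.1 (ε / 2)} := by
    ext y
    simp only [Set.mem_iUnion, Set.mem_ofPred_eq]
    refine ⟨fun hy => ?_, fun ⟨_, hy, _⟩ => hy⟩
    have hmem : (ν y, m y) ∈ Metric.closedBall
        (0 : EuclideanSpace ℝ (Fin n) × EuclideanSpace ℝ (Fin n)) 1 := by
      rw [mem_closedBall_zero_iff, Prod.norm_mk, hν y hy, hm y hy, max_self]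
    obtain ⟨p, hp, hyp⟩ := Set.mem_iUnion₂.1 (hcover hmem)
    exact ⟨⟨p, hp⟩, hy, hyp⟩
  have := hF.to_subtype
  rw [hTF]
  refine IsFinitelyRectifiable.iUnion fun p => ?_
  rcases Set.eq_empty_or_nonempty {y ∈ T | (ν y, m y) ∈ Metric.ball p.1 (ε / 2)} with
    hempty | ⟨y₀, hy₀, hy₀p⟩
  · rw [hempty]; exact IsFinitelyRectifiable.empty
  have hclose : ∀ y, (ν y, m y) ∈ Metric.ball p.1 (ε / 2) →
      ‖ν y₀ - ν y‖ ≤ ε ∧ ‖m y₀ - m y‖ ≤ ε := fun y hy => by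
    have h1 : dist (ν y₀, m y₀) (ν y, m y) ≤ ε := by
      have h2 := dist_triangle_right (ν y₀, m y₀) (ν y, m y) p.1
      rw [Metric.mem_ball] at hy hy₀p
      linarith
    rw [Prod.dist_eq, max_le_iff, dist_eq_norm, dist_eq_norm] at h1
    exact h1
  obtain ⟨π, hπ⟩ := exists_projection_orthonormal_pair (hν y₀ hy₀) (hm y₀ hy₀) (hνm y₀ hy₀)
  -- by symmetry, the increment may be taken to point to the side of `m y₀`
  have key : ∀ y ∈ T, (ν y, m y) ∈ Metric.ball p.1 (ε / 2) → ∀ y' ∈ T,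
      (ν y', m y') ∈ Metric.ball p.1 (ε / 2) → 0 ≤ ⟪m y₀, y' - y⟫ →
      ‖y' - y‖ ≤ 3 * (1 + R * K) * ‖π (y' - y)‖ := by
    intro y hy hyp y' hy' hyp' hβ
    have hb : ‖ν y' - ν y‖ ≤ K * ‖y' - y‖ := hLip y' hy' y hy
    have h1 := hnormal y hy y' hy'
    have h2 := hnormal y' hy' y hy
    have h2' : 0 ≤ ⟪ν y', y' - y⟫ := by
      rw [← neg_sub, inner_neg_right] at h2; linarith
    rw [hπ]
    refine norm_le_of_increment (hν y₀ hy₀) (hm y₀ hy₀) (hνm y₀ hy₀) rfl rfl rfl hK (ht y hy)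
      (htR y hy) hε.le hε' hb ?_ ?_ hβ ?_
    · rw [real_inner_comm, inner_sub_left]; linarith
    · have e1 : ⟪ν y₀, y' - y⟫ = ⟪ν y₀ - ν y, y' - y⟫ + ⟪ν y, y' - y⟫ := by
        rw [inner_sub_left]; ring
      have e2 : ⟪ν y₀, y' - y⟫ = ⟪ν y₀ - ν y', y' - y⟫ + ⟪ν y', y' - y⟫ := by
        rw [inner_sub_left]; ring
      have g1 : ⟪ν y₀ - ν y, y' - y⟫ ≤ ε * ‖y' - y‖ :=
        (real_inner_le_norm _ _).trans (by gcongr; exact (hclose y hyp).1)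
      have g2 : -⟪ν y₀ - ν y', y' - y⟫ ≤ ε * ‖y' - y‖ :=
        (neg_le_abs _).trans ((abs_real_inner_le_norm _ _).trans
          (by gcongr; exact (hclose y' hyp').1))
      rw [abs_le]
      constructor <;> linarith
    · have e1 : ⟪m y₀, y' - y⟫ + t y * ⟪m y₀, ν y' - ν y⟫ =
          ⟪m y₀ - m y', (y' - y) + t y • (ν y' - ν y)⟫ - ⟪m y', y + t y • ν y - y'⟫ := by
        have h3 : ⟪m y', ν y'⟫ = 0 := by rw [real_inner_comm, hνm y' hy']
        simp only [inner_sub_left, inner_sub_right, inner_add_right, inner_smul_right, h3]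
        ring
      have g1 := hsupp y' hy' y hy
      have g2 : ‖(y' - y) + t y • (ν y' - ν y)‖ ≤ (1 + R * K) * ‖y' - y‖ := by
        refine (norm_add_le _ _).trans ?_
        rw [norm_smul, Real.norm_of_nonneg (ht y hy)]
        have : t y * ‖ν y' - ν y‖ ≤ R * (K * ‖y' - y‖) :=
          mul_le_mul (htR y hy) hb (norm_nonneg _) hR
        linarith
      have g3 : ⟪m y₀ - m y', (y' - y) + t y • (ν y' - ν y)⟫ ≤
          ε * ((1 + R * K) * ‖y' - y‖) :=
        (real_inner_le_norm _ _).trans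
          (mul_le_mul (hclose y' hyp').2 g2 (norm_nonneg _) hε.le)
      linarith
  refine IsFinitelyRectifiable.of_antilipschitz (hT.subset fun y hy => hy.1) π
    (C := 3 * (1 + R * K)) (by positivity) ?_
  rintro y ⟨hy, hyp⟩ y' ⟨hy', hyp'⟩
  rcases le_total 0 ⟪m y₀, y' - y⟫ with h | h
  · rw [← neg_sub y' y, map_neg, norm_neg, norm_neg]
    exact key y hy hyp y' hy' hyp' h
  · refine key y' hy' hyp' y hy hyp ?_
    rw [← neg_sub, inner_neg_right]
    linarith

end Pieces

/-! ### The boundary of the shadow -/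

section Shadow

variable {E : Type*} [NormedAddCommGroup E] [InnerProductSpace ℝ E]

/-- The shadow of an open set is relatively open: the normals depend continuously on the boundary
point, so the normal ray from a nearby point still meets the set. -/
theorem isOpen_shadow [CompleteSpace E] {Λ Ω : Set E} (hΛ : IsConvexDomain Λ)
    (hΛr : HasC11Boundary Λ) (hΩ : IsOpen Ω) (hdisj : Disjoint (closure Ω) (closure Λ)) :
    IsOpen {y : frontier Λ | (y : E) ∈ projectionImage Λ Ω} := by
  rw [Metric.isOpen_iff]
  rintro ⟨y, hy⟩ ⟨x, hx, hxy⟩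
  have hne : x ≠ y := by
    rintro rfl
    exact hdisj.ne_of_mem (subset_closure hx) hxy.1 rfl
  obtain ⟨ν, hν, hxν⟩ := hxy.exists_isUnitNormal hΛ.convex hne
  obtain ⟨r, hr, K, hK, hLip⟩ := hΛr.exists_lipschitz_normal hy
  obtain ⟨δ, hδ, hball⟩ := Metric.isOpen_iff.1 hΩ x hx
  set t := dist x y with ht
  have ht0 : 0 ≤ t := dist_nonneg
  have hpos : 0 < 1 + t * K := by positivity
  refine ⟨min r (δ / (1 + t * K)), by positivity, ?_⟩
  rintro ⟨z, hz⟩ hzy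
  rw [Metric.mem_ball, lt_min_iff, Subtype.dist_eq, lt_div_iff₀ hpos] at hzy
  obtain ⟨ν', hν'⟩ := hΛ.exists_isUnitNormal hz
  refine ⟨z + t • ν', hball ?_, hν'.isProjection (frontier_subset_closure hz) ht0⟩
  rw [mem_ball_iff_norm, hxν]
  have h1 : ‖ν' - ν‖ ≤ K * ‖z - y‖ :=
    hLip z hz y hy hzy.1 (Metric.mem_ball_self hr) ν' ν hν' hν
  have h2 := hzy.2
  rw [dist_eq_norm] at h2
  have e : z + t • ν' - (y + t • ν) = (z - y) + t • (ν' - ν) := by module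
  rw [e]
  refine lt_of_le_of_lt ((norm_add_le _ _).trans ?_) h2
  rw [norm_smul, Real.norm_of_nonneg ht0]
  have h3 : t * ‖ν' - ν‖ ≤ t * (K * ‖z - y‖) := by gcongr
  linarith

theorem isCompact_projectionImage {E : Type*} [PseudoMetricSpace E] [ProperSpace E] {L W : Set E}
    (hW : IsCompact W) (hL : L.Nonempty) : IsCompact (projectionImage L W) := by
  obtain ⟨z₀, hz₀⟩ := hL
  obtain ⟨C, hC⟩ := hW.isBounded.subset_closedBall z₀
  have hclosed : IsClosed {p : E × E | IsProjection L p.1 p.2} := by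
    have : {p : E × E | IsProjection L p.1 p.2} =
        {p | p.2 ∈ closure L} ∩ ⋂ z ∈ closure L, {p : E × E | dist p.1 p.2 ≤ dist p.1 z} := by
      ext p; simp [IsProjection]
    rw [this]
    refine (isClosed_closure.preimage continuous_snd).inter (isClosed_biInter fun z _ => ?_)
    exact isClosed_le (by fun_prop) (by fun_prop)
  have hcomp := ((hW.prod (isCompact_closedBall z₀ (2 * C))).inter_right hclosed).image
    continuous_snd
  convert hcomp using 1
  ext y
  constructor
  · rintro ⟨x, hx, hxy⟩
    refine ⟨(x, y), ⟨⟨hx, ?_⟩, hxy⟩, rfl⟩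
    have h1 := hC hx
    have h2 := hxy.2 z₀ (subset_closure hz₀)
    have h3 := dist_triangle_left y z₀ x
    rw [Metric.mem_closedBall] at h1
    exact h3.trans (by linarith)
  · rintro ⟨⟨x, y⟩, ⟨⟨hx, -⟩, hxy⟩, rfl⟩
    exact ⟨x, hx, hxy⟩

/-- At a point of the shadow boundary the normal ray meets `closure Ω`, by compactness, but not `Ω`,
since the shadow is relatively open. -/
theorem mem_shadowBoundary [ProperSpace E] {Λ Ω : Set E} (hΛ : IsConvexDomain Λ)
    (hΛr : HasC11Boundary Λ) (hΩ : IsOpen Ω) (hΩb : Bornology.IsBounded Ω)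
    (hdisj : Disjoint (closure Ω) (closure Λ)) {y : E} (hy : y ∈ shadowBoundary Λ Ω) :
    y ∈ frontier Λ ∧ y ∈ projectionImage Λ (closure Ω) ∧ y ∉ projectionImage Λ Ω := by
  have : CompleteSpace E := inferInstance
  obtain ⟨⟨y, hyΛ⟩, hyf, rfl⟩ := hy
  rw [(isOpen_shadow hΛ hΛr hΩ hdisj).frontier_eq] at hyf
  refine ⟨hyΛ, ?_, hyf.2⟩
  refine closure_minimal (t := Subtype.val ⁻¹' projectionImage Λ (closure Ω)) ?_ ?_ hyf.1
  · rintro z ⟨x, hx, hxz⟩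
    exact ⟨x, subset_closure hx, hxz⟩
  · exact (isCompact_projectionImage hΩb.isCompact_closure
      hΛ.nonempty).isClosed.preimage continuous_subtype_val

/-- A line that misses an open convex set lies in a hyperplane that has the set on one side: the
separating functional is bounded on the line, hence vanishes on its direction `ν`. -/
theorem exists_supporting_normal_of_line [CompleteSpace E] {Ω : Set E} (hΩ : IsConvexDomain Ω)
    {y ν : E} (h : ∀ s : ℝ, y + s • ν ∉ Ω) :
    ∃ m : E, ‖m‖ = 1 ∧ ⟪ν, m⟫ = 0 ∧ ∀ w ∈ closure Ω, 0 ≤ ⟪m, w - y⟫ := by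
  have hconv : Convex ℝ (Set.range fun s : ℝ => y + s • ν) := by
    rintro _ ⟨s, rfl⟩ _ ⟨s', rfl⟩ a b - - hab
    refine ⟨a * s + b * s', ?_⟩
    obtain rfl : b = 1 - a := by linarith
    module
  obtain ⟨f, u, hf, hu⟩ := geometric_hahn_banach_open hΩ.convex hΩ.isOpen hconv
    (Set.disjoint_left.2 (by rintro _ hz ⟨s, rfl⟩; exact h s hz))
  have hu' : ∀ s : ℝ, u ≤ f y + s * f ν := fun s => by
    simpa using hu _ ⟨s, rfl⟩
  have hfν : f ν = 0 := by
    by_contra hne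
    have := hu' ((u - 1 - f y) / f ν)
    rw [div_mul_cancel₀ _ hne] at this
    linarith
  have hfy : ∀ w ∈ Ω, f w < f y := fun w hw => by
    have := hu' 0
    linarith [hf w hw]
  set g := (InnerProductSpace.toDual ℝ E).symm f with hg
  have hgf : ∀ z, ⟪g, z⟫ = f z := fun z => InnerProductSpace.toDual_symm_apply
  have hg0 : 0 < ‖g‖ := by
    rw [norm_pos_iff]
    intro h0
    obtain ⟨p, hp⟩ := hΩ.nonempty
    have := hfy p hp
    simp [← hgf, h0] at this
  refine ⟨-(‖g‖⁻¹ • g), ?_, ?_, fun w hw => ?_⟩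
  · rw [norm_neg, norm_smul, norm_inv, norm_norm, inv_mul_cancel₀ hg0.ne']
  · rw [real_inner_comm, inner_neg_left, real_inner_smul_left, hgf, hfν, mul_zero, neg_zero]
  · rw [inner_neg_left, real_inner_smul_left, hgf, map_sub, ← mul_neg, neg_sub]
    refine mul_nonneg (by positivity) (sub_nonneg.2 ?_)
    exact closure_minimal (fun z hz => (hfy z hz).le)
      (isClosed_le f.continuous continuous_const) hw

/-- A point `y` of the shadow boundary is the projection of a point of `closure Ω` on the normal ray
from `y`, and the line through this ray lies in a hyperplane that supports `Ω`. -/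
theorem exists_normals_of_mem_shadowBoundary [ProperSpace E] {Λ Ω : Set E}
    (hΛ : IsConvexDomain Λ) (hΛr : HasC11Boundary Λ) (hΩ : IsConvexDomain Ω)
    (hΩb : Bornology.IsBounded Ω) (hdisj : Disjoint (closure Ω) (closure Λ)) {z₀ : E}
    (hz₀ : z₀ ∈ Λ) {R : ℝ} (hR : closure Ω ⊆ Metric.closedBall z₀ R) {y : E}
    (hy : y ∈ shadowBoundary Λ Ω) :
    ∃ (ν m : E) (t : ℝ), IsUnitNormal Λ y ν ∧ ‖m‖ = 1 ∧ ⟪ν, m⟫ = 0 ∧ 0 ≤ t ∧ t ≤ R ∧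
      y + t • ν ∈ closure Ω ∧ ∀ w ∈ closure Ω, 0 ≤ ⟪m, w - y⟫ := by
  have : CompleteSpace E := inferInstance
  obtain ⟨hyΛ, ⟨x, hx, hxy⟩, hnot⟩ := mem_shadowBoundary hΛ hΛr hΩ.isOpen hΩb hdisj hy
  have hycl := frontier_subset_closure hyΛ
  have hne : x ≠ y := by
    rintro rfl
    exact hdisj.ne_of_mem hx hycl rfl
  obtain ⟨ν, hν, hxν⟩ := hxy.exists_isUnitNormal hΛ.convex hne
  have hline : ∀ s : ℝ, y + s • ν ∉ Ω := by
    intro s hs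
    rcases le_or_gt 0 s with h0 | h0
    · exact hnot ⟨_, hs, hν.isProjection hycl h0⟩
    · -- otherwise `y` lies on a segment from a point of `Ω` to a point of its closure
      have ht : 0 < dist x y := dist_pos.2 hne
      have hd : 0 < dist x y - s := by linarith
      have hseg : y ∈ openSegment ℝ (y + s • ν) x := by
        refine ⟨dist x y / (dist x y - s), -s / (dist x y - s), by positivity,
          div_pos (by linarith) hd, by field_simp; ring, ?_⟩
        calc _ = (dist x y / (dist x y - s)) • (y + s • ν) +
              (-s / (dist x y - s)) • (y + dist x y • ν) := by rw [← hxν]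
          _ = y := by
            generalize dist x y = d at hd
            match_scalars
            · field_simp
              ring
            · field_simp
              ring
      have := hΩ.convex.openSegment_interior_closure_subset_interior
        (by rwa [hΩ.isOpen.interior_eq]) hx hseg
      exact hdisj.ne_of_mem (subset_closure (interior_subset this)) hycl rfl
  obtain ⟨m, hm, hνm, hsupp⟩ := exists_supporting_normal_of_line hΩ hline
  refine ⟨ν, m, dist x y, hν, hm, hνm, dist_nonneg, ?_, hxν ▸ hx, hsupp⟩
  exact (hxy.2 z₀ (subset_closure hz₀)).trans (hR hx)

end Shadow

end ProjectionShadow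

open ProjectionShadow in
theorem mainTheorem3 (n : ℕ) (hn : 2 ≤ n) (Ω Λ : Set (EuclideanSpace ℝ (Fin n)))
    (hΩ : ProjectionShadow.IsStrictlyConvexDomain Ω) (hΩb : Bornology.IsBounded Ω)
    (hΛ : ProjectionShadow.IsConvexDomain Λ) (hΛr : ProjectionShadow.HasC11Boundary Λ)
    (hdisj : Disjoint (closure Ω) (closure Λ)) :
    ProjectionShadow.IsFinitelyRectifiable (n - 2) (ProjectionShadow.shadowBoundary Λ Ω) := by
  obtain ⟨z₀, hz₀⟩ := hΛ.nonempty
  obtain ⟨R, hR0, hR⟩ := hΩb.closure.subset_closedBall_lt 0 z₀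
  have hΩc := hΩ.toIsConvexDomain
  choose! ν m t hν hm hνm ht htR hx hsupp using
    fun y (hy : y ∈ shadowBoundary Λ Ω) =>
      exists_normals_of_mem_shadowBoundary hΛ hΛr hΩc hΩb hdisj hz₀ hR hy
  have hmem := fun y (hy : y ∈ shadowBoundary Λ Ω) =>
    mem_shadowBoundary hΛ hΛr hΩc.isOpen hΩb hdisj hy
  have hcpt : IsCompact (projectionImage Λ (closure Ω) ∩ frontier Λ) :=
    (isCompact_projectionImage hΩb.isCompact_closure hΛ.nonempty).inter_right isClosed_frontier
  choose! r hr K hK hLip using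
    fun y (hy : y ∈ frontier Λ) => hΛr.exists_lipschitz_normal hy
  obtain ⟨F, hF, hcover⟩ := hcpt.elim_nhds_subcover (fun y => Metric.ball y (r y))
    fun y hy => Metric.ball_mem_nhds y (hr y hy.2)
  have hcov : shadowBoundary Λ Ω = ⋃ p : F, shadowBoundary Λ Ω ∩ Metric.ball p.1 (r p.1) := by
    ext y
    simp only [Set.mem_iUnion, Set.mem_inter_iff]
    refine ⟨fun hy => ?_, fun ⟨_, hy, _⟩ => hy⟩
    obtain ⟨p, hp, hyp⟩ := Set.mem_iUnion₂.1 (hcover ⟨(hmem y hy).2.1, (hmem y hy).1⟩)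
    exact ⟨⟨p, hp⟩, hy, hyp⟩
  rw [hcov]
  refine IsFinitelyRectifiable.iUnion fun p => ?_
  have hp : p.1 ∈ frontier Λ := (hF p.1 p.2).2
  refine isFinitelyRectifiable_of_normals (Metric.isBounded_ball.subset Set.inter_subset_right)
    ν m t hR0.le (hK p.1 hp) (fun y hy => (hν y hy.1).norm_eq) (fun y hy => hm y hy.1)
    (fun y hy => hνm y hy.1) (fun y hy => ht y hy.1) (fun y hy => htR y hy.1)
    (fun y hy y' hy' => ?_) (fun y hy y' hy' => hsupp y hy.1 _ (hx y' hy'.1))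
    (fun y hy y' hy' => ?_)
  · exact (hν y hy.1).inner_le y' (frontier_subset_closure (hmem y' hy'.1).1)
  · exact hLip p.1 hp y (hmem y hy.1).1 y' (hmem y' hy'.1).1 hy.2 hy'.2 _ _ (hν y hy.1)
      (hν y' hy'.1)
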